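/- Let $n\ge 0$, $[n]=\{1,\dots,n\}$, and let $L(E)$ denote the space of real functions on a finite set $E$. **Words.** An injective word over $[n]$ is a (possibly empty) word with pairwise distinct letters in $[n]$; its content $c(\omega)$ is its set of letters, and $\Gamma_n$ is the set of all injective words. Elements of $L(\Gamma_n)$ are written as linear combinations of words. The concatenation product on $L(\Gamma_n)$ is the bilinear product with $(\omega,\omega')\mapsto\omega\omega'$ if $c(\omega)\cap c(\omega')=\emptyset$ and $(\omega,\omega')\mapsto 0$ otherwise, and $x\diamond y=xy-yx$. For $a\in[n]$, $\varrho_a$ is the linear operator on $L(\Gamma_n)$ that deletes the letter $a$ from each word (and fixes the words not containing $a$). A permutation $\sigma\in S_n$ is identified with the word $\sigma^{-1}(1)\dots\sigma^{-1}(n)$. **Spaces.** For $A\subset[n]$ with $|A|\ge 2$ let $H_A$ be the space of all linear combinations $x$ of words of content $A$ such that $\varrho_a x=0$ for all $a\in A$. Let $\phi_n:L(\Gamma_n)\to L(S_n)$ be the linear map sending a word $\pi$ to the indicator function of the set of permutations whose word contains $\pi$ as a contiguous subword, and put $W_A=\phi_n(H_A)$. Let $V^0\subset L(S_n)$ be the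 space of constant functions. **Wavelets.** Let $\tau\in S_n$, $\tau\neq \mathrm{id}$, and write $\tau$ as the product of its nontrivial cycles, each cycle $(a_1\,a_2\dots a_m)$ (with $\tau(a_i)=a_{i+1}$) starting with its smallest element and the cycles being arranged from left to right in increasing order of their smallest elements. Insert a symbol $\star$ between any two consecutive letters of each cycle. As long as there are symbols $\star$, take the one whose right-hand neighbouring letter is the largest; if it stands between the quantities $Q$ and $R$, replace $Q\star R$ by $(Q\diamond R)$. When no $\star$ is left, the concatenation product, from left to right, of the resulting quantities is the chain $x_\tau\in L(\Gamma_n)$. Set $\psi_\tau=\phi_n(x_\tau)$ for $\tau\ne\mathrm{id}$, and let $\psi_{\mathrm{id}}$ be the constant function $1$. **Theorem.** For every $A\subset[n]$ with $|A|\ge2$, the family $(\psi_\tau)$, where $\tau$ runs over the permutations in $S_n$ with support $\{i:\tau(i)\ne i\}$ equal to $A$, is a basis of $W_A$. Moreover, $(\psi_\tau)_{\tau\in S_n}$ is a basis of $L(S_n)$. This basis is adapted to the decomposition $$L(S_n)=V^0\oplus\bigoplus_{A\subset[n],\,|A|\ge2}W_A,$$ that is, this direct sum decomposition holds, $\psi_{\mathrm{id}}=1$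 spans $V^0$, and for each $A$ the $\psi_\tau$ with $\tau$ of support $A$ form a basis of $W_A$. -/

import Mathlib

namespace InjectiveWords

noncomputable section

/-- The set `Γ_n` of injective words over an alphabet of `n` letters, empty word included.
The letters are the elements of `Fin n`, in their usual order. -/
abbrev InjWord (n : ℕ) : Type := {w : List (Fin n) // w.Nodup}

/-- The content `c(ω)`: the set of letters of `ω`. -/
def content {n : ℕ} (w : InjWord n) : Finset (Fin n) := w.1.toFinset

/-- The empty word. -/
def emptyWord (n : ℕ) : InjWord n := ⟨[], List.nodup_nil⟩

/-- A one-letter word. -/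
def letter {n : ℕ} (a : Fin n) : InjWord n := ⟨[a], List.nodup_singleton a⟩

/-- The word obtained from `ω` by deleting the letter `a`
(the word `ω` itself if `a` does not occur in `ω`). -/
def deleteLetter {n : ℕ} (a : Fin n) (w : InjWord n) : InjWord n := ⟨w.1.erase a, w.2.erase a⟩

/-- Concatenation of two injective words with disjoint contents. -/
def concatWord {n : ℕ} (v w : InjWord n) (h : Disjoint (content v) (content w)) : InjWord n :=
  ⟨v.1 ++ w.1, v.2.append w.2 (List.disjoint_toFinset_iff_disjoint.mp h)⟩

/-- The space `L(Γ_n)` of chains `∑ x(ω) ω`, i.e. of real functions on the finite set `Γ_n`;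
the Dirac function of `ω` is `Finsupp.single ω 1`. -/
abbrev Chain (n : ℕ) : Type := InjWord n →₀ ℝ

/-- The space `L(S_n)` of real functions on the symmetric group. -/
abbrev PermFn (n : ℕ) : Type := Equiv.Perm (Fin n) → ℝ

/-- The deletion operator `ϱ_a` on chains. -/
def deletion {n : ℕ} (a : Fin n) : Chain n →ₗ[ℝ] Chain n :=
  Finsupp.lmapDomain ℝ ℝ (deleteLetter a)

/-- The concatenation product of chains: bilinear, given on words by concatenation if the
contents are disjoint and by `0` otherwise. -/
def concat {n : ℕ} : Chain n →ₗ[ℝ] Chain n →ₗ[ℝ] Chain n :=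
  Finsupp.linearCombination ℝ fun v : InjWord n =>
    Finsupp.linearCombination ℝ fun w : InjWord n =>
      if h : Disjoint (content v) (content w) then Finsupp.single (concatWord v w h) (1 : ℝ) else 0

/-- The diamond operator `x ◇ y = xy - yx`. -/
def diamond {n : ℕ} (x y : Chain n) : Chain n := concat x y - concat y x

/-- The space `H_A` of chains on words with content `A` that are killed by `ϱ_a` for all `a ∈ A`. -/
def H {n : ℕ} (A : Finset (Fin n)) : Submodule ℝ (Chain n) :=
  Finsupp.supported ℝ ℝ {w : InjWord n | content w = A} ⊓ ⨅ a ∈ A, LinearMap.ker (deletion a)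

/-- The word `σ⁻¹(1) … σ⁻¹(n)` of a permutation `σ`, where `σ(a)` is the rank of the item `a`. -/
def permWord {n : ℕ} (σ : Equiv.Perm (Fin n)) : InjWord n :=
  ⟨List.ofFn fun i => σ.symm i, List.nodup_ofFn.mpr σ.symm.injective⟩

/-- The set `S_n[π]` of permutations whose word has `π` as a contiguous subword. -/
def permsContaining {n : ℕ} (w : InjWord n) : Set (Equiv.Perm (Fin n)) :=
  {σ | w.1 <:+: (permWord σ).1}

/-- The embedding operator `φ_n : L(Γ_n) → L(S_n)`, sending the word `π` to the indicator function
of `S_n[π]`. -/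
def embedding (n : ℕ) : Chain n →ₗ[ℝ] PermFn n :=
  Finsupp.linearCombination ℝ fun w : InjWord n => (permsContaining w).indicator fun _ => (1 : ℝ)

/-- The space `W_A = φ_n(H_A)`. -/
def W {n : ℕ} (A : Finset (Fin n)) : Submodule ℝ (PermFn n) := (H A).map (embedding n)

/-- The space `V⁰` of constant functions on `S_n`. -/
def constFns (n : ℕ) : Submodule ℝ (PermFn n) where
  carrier := {f | ∃ c : ℝ, ∀ σ, f σ = c}
  add_mem' := by
    rintro f g ⟨c, hc⟩ ⟨d, hd⟩
    exact ⟨c + d, fun σ => by simp [hc, hd]⟩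
  zero_mem' := ⟨0, fun _ => rfl⟩
  smul_mem' := by
    rintro r f ⟨c, hc⟩
    exact ⟨r * c, fun σ => by simp [hc]⟩

/-- The standard cycle form of `τ`: the list of its nontrivial cycles, each written
`[a, τ a, τ² a, …]` with `a` the minimum of the cycle, in increasing order of these minima. -/
def standardCycleForm {n : ℕ} (τ : Equiv.Perm (Fin n)) : List (List (Fin n)) :=
  ((List.finRange n).filter fun a => τ a ≠ a ∧ ∀ b, τ.SameCycle a b → a ≤ b).map τ.toList

/-- A quantity in the string that the algorithm manipulates. The string is a list of such
quantities; `star` says whether the symbol `⋆` stands immediately to the left of the quantity,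
`lead` is the leftmost letter of the quantity, and `chain` is its value. -/
structure Quantity (n : ℕ) where
  star : Bool
  lead : Fin n
  chain : Chain n

/-- The string `a₁ ⋆ a₂ ⋆ … ⋆ aₘ` of a cycle `(a₁ a₂ … aₘ)`. -/
def cycleString {n : ℕ} : List (Fin n) → List (Quantity n)
  | [] => []
  | a :: l => ⟨false, a, Finsupp.single (letter a) 1⟩ ::
      l.map fun b => ⟨true, b, Finsupp.single (letter b) 1⟩

/-- The initial string of the algorithm: the strings of the cycles of `τ`, written one after the
other in standard cycle form (without a symbol `⋆` between distinct cycles). -/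
def initialString {n : ℕ} (τ : Equiv.Perm (Fin n)) : List (Quantity n) :=
  (standardCycleForm τ).flatMap cycleString

/-- The largest right-hand neighbour of a symbol `⋆`, if there is any symbol `⋆`. -/
def largestStar {n : ℕ} (s : List (Quantity n)) : Option (Fin n) :=
  ((s.filter fun q => q.star).map fun q => q.lead).max?

/-- Replace `Q ⋆ R` by `(Q ◇ R)`, where the symbol `⋆` is the one with right-hand neighbour `b`. -/
def contract {n : ℕ} (b : Fin n) : List (Quantity n) → List (Quantity n)
  | [] => []
  | [Q] => [Q]
  | Q :: R :: s =>
      if R.star = true ∧ R.lead = b then ⟨Q.star, Q.lead, diamond Q.chain R.chain⟩ :: s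
      else Q :: contract b (R :: s)

/-- One round of the algorithm; nothing changes when there is no symbol `⋆` left. -/
def step {n : ℕ} (s : List (Quantity n)) : List (Quantity n) :=
  match largestStar s with
  | none => s
  | some b => contract b s

/-- The chain `x_τ`: the concatenation product of the quantities left when the algorithm halts.
Each round removes one symbol `⋆` and there are fewer than `n` of them (none if `n = 0`),
so that `n` rounds lead to the halt. -/
def waveletChain {n : ℕ} (τ : Equiv.Perm (Fin n)) : Chain n :=
  (step^[n] (initialString τ)).foldr (fun q y => concat q.chain y)
    (Finsupp.single (emptyWord n) 1)

/-- The wavelet functions: `ψ_id` is the constant function `1`, and `ψ_τ = φ_n(x_τ)` otherwise. -/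
def wavelet {n : ℕ} (τ : Equiv.Perm (Fin n)) : PermFn n :=
  if τ = 1 then fun _ => 1 else embedding n (waveletChain τ)

/-- The family consisting of `V⁰` (index `none`) and of the spaces `W_A`, `|A| ≥ 2`. -/
def multiresolution (n : ℕ) :
    Option {A : Finset (Fin n) // 2 ≤ A.card} → Submodule ℝ (PermFn n)
  | none => constFns n
  | some A => W A.1

end

end InjectiveWords

namespace InjectiveWords

/-! ### Concatenation and deletion on chains -/

/-! There are `n!` wavelets in a space of dimension `n!`, so everything follows from two
independence statements, one about the chains `x_τ` and one about the spaces `H A`.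

Chains. Read words from right to left and order them lexicographically. When `Q` starts with a
smaller letter than `R`, the smallest word of `Q ◇ R` comes from `-RQ`; contracting the largest star
first guarantees this inequality at every round. Hence the smallest word of `x_τ`, so read, lists
the cycles of `τ` by decreasing minima. This is Foata's correspondence, from which `τ` can be
recovered, so the `x_τ` are independent (`linearIndependent_waveletChain`). Each bracket of at least
two letters is killed by deleting any of its letters, so `x_τ ∈ H τ.support` (`waveletChain_mem_H`).

Spaces. The marginal of `φ_n(x)` on a letter set `B` vanishes if `x ∈ H A` and `A ⊄ B`, while for `B
= A` it determines `x`. Induction on `A` then shows that `φ_n` is injective on the sum of all `H A`,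
with independent components (`eq_zero_of_embedding_sum_eq_zero`).

Together these make the wavelets a basis. Comparing components shows that those of support `A` span
`W A`, with no need to compute the dimension of `H A`. The constants are the case `A = ∅`. -/

theorem concat_single_single {n : ℕ} (v w : InjWord n) (r s : ℝ) :
    concat (Finsupp.single v r) (Finsupp.single w s) =
      if h : Disjoint (content v) (content w) then
        Finsupp.single (concatWord v w h) (r * s) else 0 := by
  by_cases h : Disjoint (content v) (content w) <;> simp [concat, h]

theorem concat_eq_sum {n : ℕ} (x y : Chain n) :
    concat x y = x.sum fun v r => y.sum fun w s =>
      concat (Finsupp.single v r) (Finsupp.single w s) := by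
  conv_lhs => rw [← Finsupp.sum_single x, ← Finsupp.sum_single y]
  simp only [Finsupp.sum, map_sum, LinearMap.coe_sum, Finset.sum_apply]
  rw [Finset.sum_comm]

theorem concat_single_empty_left {n : ℕ} (y : Chain n) :
    concat (Finsupp.single (emptyWord n) 1) y = y := by
  induction y using Finsupp.induction_linear with
  | zero => simp
  | add f g hf hg => rw [map_add, hf, hg]
  | single w s =>
    rw [concat_single_single, dif_pos (by simp [content, emptyWord])]
    simp [concatWord, emptyWord]

theorem concat_single_empty_right {n : ℕ} (x : Chain n) :
    concat x (Finsupp.single (emptyWord n) 1) = x := by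
  induction x using Finsupp.induction_linear with
  | zero => simp
  | add f g hf hg => rw [map_add, LinearMap.add_apply, hf, hg]
  | single w s =>
    rw [concat_single_single, dif_pos (by simp [content, emptyWord])]
    simp [concatWord, emptyWord]

theorem exists_append_of_mem_support_concat {n : ℕ} {x y : Chain n} {z : InjWord n}
    (hz : z ∈ (concat x y).support) :
    ∃ v ∈ x.support, ∃ w ∈ y.support, z.1 = v.1 ++ w.1 := by
  classical
  rw [concat_eq_sum] at hz
  obtain ⟨v, hv, hz⟩ := Finsupp.mem_support_finsetSum z hz
  obtain ⟨w, hw, hz⟩ := Finsupp.mem_support_finsetSum z hz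
  refine ⟨v, hv, w, hw, ?_⟩
  beta_reduce at hz
  rw [concat_single_single] at hz
  split_ifs at hz with h
  · have := Finsupp.support_single_subset hz
    rw [Finset.mem_singleton] at this
    rw [this, concatWord]
  · simp at hz

/-- With all words of `x` of one length, `z` can be cut in only one place, so no other pair of words
contributes to its coefficient. -/
theorem concat_apply_append {n : ℕ} {x y : Chain n} {v w z : InjWord n}
    (hz : z.1 = v.1 ++ w.1) (hx : ∀ v' ∈ x.support, v'.1.length = v.1.length) :
    concat x y z = x v * y w := by
  classical
  have hd : Disjoint (content v) (content w) := by
    have := z.2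
    rw [hz] at this
    exact List.disjoint_toFinset_iff_disjoint.mpr (List.disjoint_of_nodup_append this)
  have hzc : z = concatWord v w hd := Subtype.ext hz
  rw [concat_eq_sum, Finsupp.sum_apply, Finsupp.sum, Finset.sum_eq_single v]
  · rw [Finsupp.sum_apply, Finsupp.sum, Finset.sum_eq_single w]
    · rw [concat_single_single, dif_pos hd, hzc, Finsupp.single_eq_same]
    · intro w' _ hw'
      rw [concat_single_single]
      split_ifs with h
      · rw [Finsupp.single_eq_of_ne]
        intro he
        have := congrArg Subtype.val he
        simp only [concatWord, hz] at this
        exact hw' (Subtype.ext (List.append_cancel_left this).symm)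
      · rfl
    · intro hw
      simp [Finsupp.notMem_support_iff.mp hw]
  · intro v' hv' hne
    rw [Finsupp.sum_apply]
    refine Finset.sum_eq_zero fun w' _ => ?_
    beta_reduce
    rw [concat_single_single]
    split_ifs with h
    · rw [Finsupp.single_eq_of_ne]
      intro he
      have := congrArg Subtype.val he
      simp only [concatWord, hz] at this
      exact hne (Subtype.ext (List.append_inj_left this (hx v' hv').symm).symm)
    · rfl
  · intro hv
    simp [Finsupp.notMem_support_iff.mp hv]

theorem deletion_single {n : ℕ} (a : Fin n) (w : InjWord n) (r : ℝ) :
    deletion a (Finsupp.single w r) = Finsupp.single (deleteLetter a w) r := by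
  simp [deletion]

theorem content_deleteLetter {n : ℕ} (a : Fin n) (w : InjWord n) :
    content (deleteLetter a w) = (content w).erase a := by
  ext b
  simp [content, deleteLetter, w.2.mem_erase_iff]

/-- As `a` does not occur in `y`, removing it from a left factor neither creates nor destroys
disjointness of contents. -/
theorem deletion_concat_left {n : ℕ} {a : Fin n} (x : Chain n) {y : Chain n}
    (hy : ∀ w ∈ y.support, a ∉ w.1) :
    deletion a (concat x y) = concat (deletion a x) y := by
  induction x using Finsupp.induction_linear with
  | zero => simp
  | add f g hf hg => simp only [map_add, LinearMap.add_apply, hf, hg]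
  | single v r =>
    rw [← Finsupp.sum_single y]
    simp only [Finsupp.sum, map_sum]
    refine Finset.sum_congr rfl fun w hw => ?_
    have ha : a ∉ content w := by simpa [content] using hy w hw
    rw [deletion_single, concat_single_single, concat_single_single]
    have hiff : Disjoint (content v) (content w) ↔
        Disjoint (content (deleteLetter a v)) (content w) := by
      rw [content_deleteLetter, Finset.disjoint_left, Finset.disjoint_left]
      refine ⟨fun h b hb => h (Finset.mem_of_mem_erase hb), fun h b hb hb' => ?_⟩
      exact h (Finset.mem_erase.mpr ⟨fun e => ha (e ▸ hb'), hb⟩) hb'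
    by_cases h : Disjoint (content v) (content w)
    · rw [dif_pos h, dif_pos (hiff.mp h), deletion_single]
      congr 1
      refine Subtype.ext ?_
      simp only [deleteLetter, concatWord]
      by_cases hv : a ∈ v.1
      · rw [List.erase_append_left _ hv]
      · rw [List.erase_append_right _ hv, List.erase_of_not_mem hv,
          List.erase_of_not_mem (hy w hw)]
    · rw [dif_neg h, dif_neg (fun h' => h (hiff.mpr h')), map_zero]

theorem deletion_concat_right {n : ℕ} {a : Fin n} {x : Chain n} (y : Chain n)
    (hx : ∀ v ∈ x.support, a ∉ v.1) :
    deletion a (concat x y) = concat x (deletion a y) := by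
  induction y using Finsupp.induction_linear with
  | zero => simp
  | add f g hf hg => simp only [map_add, hf, hg]
  | single w r =>
    rw [← Finsupp.sum_single x]
    simp only [Finsupp.sum, map_sum, LinearMap.coe_sum, Finset.sum_apply]
    refine Finset.sum_congr rfl fun v hv => ?_
    have ha : a ∉ content v := by simpa [content] using hx v hv
    rw [deletion_single, concat_single_single, concat_single_single]
    have hiff : Disjoint (content v) (content w) ↔
        Disjoint (content v) (content (deleteLetter a w)) := by
      rw [content_deleteLetter, Finset.disjoint_right, Finset.disjoint_right]
      refine ⟨fun h b hb => h (Finset.mem_of_mem_erase hb), fun h b hb hb' => ?_⟩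
      exact h (Finset.mem_erase.mpr ⟨fun e => ha (e ▸ hb'), hb⟩) hb'
    by_cases h : Disjoint (content v) (content w)
    · rw [dif_pos h, dif_pos (hiff.mp h), deletion_single]
      congr 1
      refine Subtype.ext ?_
      simp only [deleteLetter, concatWord]
      rw [List.erase_append_right _ (hx v hv)]
    · rw [dif_neg h, dif_neg (fun h' => h (hiff.mpr h')), map_zero]

/-! ### Leading words -/

theorem append_lt_append_of_length_eq {α : Type*} [LinearOrder α] {u u' : List α}
    (hl : u.length = u'.length) (h : u < u') (v v' : List α) : u ++ v < u' ++ v' := by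
  induction u generalizing u' with
  | nil => cases u' with
    | nil => exact absurd h (lt_irrefl _)
    | cons a t => simp at hl
  | cons a t ih => cases u' with
    | nil => simp at hl
    | cons b s =>
      rw [List.cons_append, List.cons_append, List.cons_lt_cons_iff]
      rcases List.cons_lt_cons_iff.mp h with h | ⟨h, h'⟩
      · exact Or.inl h
      · exact Or.inr ⟨h, ih (by simpa using hl) h'⟩

theorem append_le_append_of_length_eq {α : Type*} [LinearOrder α] {u u' v v' : List α}
    (hl : u.length = u'.length) (h : u ≤ u') (h' : v ≤ v') : u ++ v ≤ u' ++ v' := by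
  rcases h.lt_or_eq with h | rfl
  · exact (append_lt_append_of_length_eq hl h v v').le
  · rcases h'.lt_or_eq with h' | rfl
    · exact (show u ++ v < u ++ v' from List.append_left_lt h').le
    · exact le_rfl

/-- All words of `x` are rearrangements of `w`, and `w.reverse` is the leading word of `x`
for the lexicographic order of the words read from right to left. -/
structure LeadsTo {n : ℕ} (x : Chain n) (w : List (Fin n)) : Prop where
  perm : ∀ v ∈ x.support, v.1.Perm w
  le : ∀ v ∈ x.support, w ≤ v.1.reverse
  coeff : ∃ v : InjWord n, v.1 = w.reverse ∧ x v ≠ 0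

theorem LeadsTo.concat {n : ℕ} {x y : Chain n} {u w : List (Fin n)} (hx : LeadsTo x u)
    (hy : LeadsTo y w) (hd : (w ++ u).Nodup) : LeadsTo (concat x y) (w ++ u) where
  perm z hz := by
    obtain ⟨v, hv, v', hv', he⟩ := exists_append_of_mem_support_concat hz
    rw [he]
    exact ((hx.perm v hv).append (hy.perm v' hv')).trans List.perm_append_comm
  le z hz := by
    obtain ⟨v, hv, v', hv', he⟩ := exists_append_of_mem_support_concat hz
    rw [he, List.reverse_append]
    exact append_le_append_of_length_eq (by simp [(hy.perm v' hv').length_eq]) (hy.le v' hv')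
      (hx.le v hv)
  coeff := by
    obtain ⟨v, hv, hxv⟩ := hx.coeff
    obtain ⟨v', hv', hyv⟩ := hy.coeff
    refine ⟨⟨(w ++ u).reverse, List.nodup_reverse.mpr hd⟩, rfl, ?_⟩
    rw [concat_apply_append (v := v) (w := v') (by simp [hv, hv'])
      (fun t ht => by simp [(hx.perm t ht).length_eq, hv])]
    exact mul_ne_zero hxv hyv

/-- Read from the right, every word of `xy` starts with a letter at least `b > a`, hence lies
strictly above the leading word of `yx`, which therefore survives in `xy - yx`. -/
theorem LeadsTo.diamond {n : ℕ} {x y : Chain n} {a b : Fin n} {u w : List (Fin n)}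
    (hx : LeadsTo x (a :: u)) (hy : LeadsTo y (b :: w)) (hab : a < b)
    (hd : ((a :: u) ++ (b :: w)).Nodup) :
    LeadsTo (diamond x y) ((a :: u) ++ (b :: w)) := by
  classical
  have hyx := hy.concat hx hd
  have hgt : ∀ z ∈ (InjectiveWords.concat x y).support, (a :: u) ++ (b :: w) < z.1.reverse := by
    intro z hz
    obtain ⟨v, hv, v', hv', he⟩ := exists_append_of_mem_support_concat hz
    rw [he, List.reverse_append]
    have h1 := hy.le v' hv'
    have h2 := (hy.perm v' hv').length_eq
    rw [← List.length_reverse] at h2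
    generalize v'.1.reverse = t at h1 h2 ⊢
    cases t with
    | nil => simp at h2
    | cons c t =>
      rw [List.cons_append, List.cons_append, List.cons_lt_cons_iff]
      rcases h1.lt_or_eq with h1 | h1
      · rcases List.cons_lt_cons_iff.mp h1 with h | ⟨h, -⟩
        · exact Or.inl (hab.trans h)
        · exact Or.inl (h ▸ hab)
      · exact Or.inl ((List.cons_eq_cons.mp h1).1 ▸ hab)
  refine ⟨fun z hz => ?_, fun z hz => ?_, ?_⟩
  · rcases Finset.mem_union.mp (Finsupp.support_sub hz) with hz | hz
    · obtain ⟨v, hv, v', hv', he⟩ := exists_append_of_mem_support_concat hz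
      rw [he]
      exact (hx.perm v hv).append (hy.perm v' hv')
    · exact hyx.perm z hz
  · rcases Finset.mem_union.mp (Finsupp.support_sub hz) with hz | hz
    · exact (hgt z hz).le
    · exact hyx.le z hz
  · obtain ⟨z, hz, hne⟩ := hyx.coeff
    refine ⟨z, hz, ?_⟩
    have h0 : InjectiveWords.concat x y z = 0 := by
      by_contra h
      have := hgt z (Finsupp.mem_support_iff.mpr h)
      rw [hz, List.reverse_reverse] at this
      exact lt_irrefl _ this
    rw [InjectiveWords.diamond, Finsupp.sub_apply, h0, zero_sub]
    exact neg_ne_zero.mpr hne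

/-- In a vanishing combination, take the index with nonzero coefficient whose leading word is
smallest: no other chain of the combination contains that word. -/
theorem linearIndependent_of_leadsTo {n : ℕ} {ι : Type*} [Fintype ι] {x : ι → Chain n}
    {m : ι → List (Fin n)} (hx : ∀ i, LeadsTo (x i) (m i)) (hm : Function.Injective m) :
    LinearIndependent ℝ x := by
  classical
  rw [Fintype.linearIndependent_iff]
  intro c hc
  by_contra! hne
  obtain ⟨i₀, hi₀⟩ := hne
  obtain ⟨i, hi, hmin⟩ := Finset.exists_min_image (Finset.univ.filter fun i => c i ≠ 0) m
    ⟨i₀, by simpa using hi₀⟩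
  obtain ⟨v, hv, hxv⟩ := (hx i).coeff
  have h := DFunLike.congr_fun hc v
  rw [Finsupp.finsetSum_apply, Finset.sum_eq_single i] at h
  · simp only [Finsupp.smul_apply, smul_eq_mul, Finsupp.coe_zero, Pi.zero_apply, mul_eq_zero] at h
    exact h.elim (Finset.mem_filter.mp hi).2 hxv
  · intro j _ hj
    by_contra h0
    rw [Finsupp.smul_apply, smul_eq_mul, mul_eq_zero, not_or] at h0
    have h1 := (hx j).le v (Finsupp.mem_support_iff.mpr h0.2)
    rw [hv, List.reverse_reverse] at h1
    exact hj (hm (le_antisymm h1 (hmin j (by simpa using h0.1))))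
  · simp

/-! ### The bracketing algorithm -/

/-- The quantity `q` is a bracketing of the word `w`. -/
structure Quantity.Spells {n : ℕ} (q : Quantity n) (w : List (Fin n)) : Prop where
  head : ∃ t, w = q.lead :: t
  leadsTo : LeadsTo q.chain w
  deletion_eq : ∀ a ∈ w, ∃ c : ℝ, deletion a q.chain = c • Finsupp.single (emptyWord n) 1
  deletion_eq_zero : 2 ≤ w.length → ∀ a ∈ w, deletion a q.chain = 0

theorem Quantity.spells_letter {n : ℕ} (s : Bool) (a : Fin n) :
    (⟨s, a, Finsupp.single (letter a) 1⟩ : Quantity n).Spells [a] where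
  head := ⟨[], rfl⟩
  leadsTo :=
    { perm := fun v hv => by
        have := Finset.mem_singleton.mp (Finsupp.support_single_subset hv)
        rw [this, letter]
      le := fun v hv => by
        have := Finset.mem_singleton.mp (Finsupp.support_single_subset hv)
        rw [this, letter, List.reverse_singleton]
      coeff := ⟨letter a, rfl, by simp⟩ }
  deletion_eq b hb := by
    rw [List.mem_singleton] at hb
    subst hb
    refine ⟨1, ?_⟩
    rw [deletion_single, one_smul]
    congr 1
    exact Subtype.ext (by simp [deleteLetter, letter, emptyWord])
  deletion_eq_zero h := by simp at h

/-- Deleting a letter of one factor turns that factor into a multiple of the empty word, the unit of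
concatenation, which commutes with the other factor; so the commutator is killed. -/
theorem Quantity.Spells.diamond {n : ℕ} {Q R : Quantity n} {u w : List (Fin n)}
    (hQ : Q.Spells u) (hR : R.Spells w) (hlt : Q.lead < R.lead) (hd : (u ++ w).Nodup) :
    (⟨Q.star, Q.lead, InjectiveWords.diamond Q.chain R.chain⟩ : Quantity n).Spells (u ++ w) := by
  have hdis := List.disjoint_of_nodup_append hd
  have h0 : ∀ a ∈ u ++ w, deletion a (InjectiveWords.diamond Q.chain R.chain) = 0 := by
    intro a ha
    rw [InjectiveWords.diamond, map_sub]
    rcases List.mem_append.mp ha with h | h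
    · have hn : ∀ v ∈ R.chain.support, a ∉ v.1 := fun v hv hav =>
        hdis h ((hR.leadsTo.perm v hv).mem_iff.mp hav)
      obtain ⟨c, hc⟩ := hQ.deletion_eq a h
      rw [deletion_concat_left _ hn, deletion_concat_right _ hn, hc, map_smul, map_smul,
        LinearMap.smul_apply, concat_single_empty_left, concat_single_empty_right, sub_self]
    · have hn : ∀ v ∈ Q.chain.support, a ∉ v.1 := fun v hv hav =>
        hdis ((hQ.leadsTo.perm v hv).mem_iff.mp hav) h
      obtain ⟨c, hc⟩ := hR.deletion_eq a h
      rw [deletion_concat_left _ hn, deletion_concat_right _ hn, hc, map_smul, map_smul,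
        LinearMap.smul_apply, concat_single_empty_left, concat_single_empty_right, sub_self]
  obtain ⟨t, ht⟩ := hQ.head
  obtain ⟨t', ht'⟩ := hR.head
  refine ⟨⟨t ++ w, by rw [ht, List.cons_append]⟩, ?_, fun a ha => ⟨0, by rw [h0 a ha, zero_smul]⟩,
    fun _ => h0⟩
  have hQl := hQ.leadsTo
  have hRl := hR.leadsTo
  rw [ht] at hQl
  rw [ht'] at hRl
  rw [ht, ht'] at hd ⊢
  exact hQl.diamond hRl hlt hd

/-- The string `s` consists of bracketings of parts of words: `g` lists the words that are
obtained by joining every quantity that is preceded by a star to its left neighbour, and `p` is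
the word of the starred quantities at the beginning of `s`. -/
inductive StringSpells {n : ℕ} : List (Quantity n) → List (Fin n) → List (List (Fin n)) → Prop
  | nil : StringSpells [] [] []
  | star {q : Quantity n} {w : List (Fin n)} {s : List (Quantity n)} {p : List (Fin n)}
      {g : List (List (Fin n))} (hq : q.star = true) (hw : q.Spells w) (hs : StringSpells s p g) :
      StringSpells (q :: s) (w ++ p) g
  | plain {q : Quantity n} {w : List (Fin n)} {s : List (Quantity n)} {p : List (Fin n)}
      {g : List (List (Fin n))} (hq : q.star = false) (hw : q.Spells w)
      (hs : StringSpells s p g) : StringSpells (q :: s) [] ((w ++ p) :: g)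

/-- A word that begins with its smallest letter, all letters being distinct from the first. -/
def HeadLt {n : ℕ} (c : List (Fin n)) : Prop := ∃ a t, c = a :: t ∧ ∀ b ∈ t, a < b

/-- The choice of the largest star matters here: the left neighbour of the contracted star has the
smaller lead, either because it is itself starred, with lead at most `b`, or because it begins a
cycle and leads with the minimum. -/
theorem StringSpells.contract {n : ℕ} {b : Fin n} {s : List (Quantity n)} {p : List (Fin n)}
    {g : List (List (Fin n))} (hs : StringSpells s p g) (hd : (p ++ g.flatten).Nodup)
    (hg : ∀ c ∈ g, HeadLt c) (hb : ∀ q ∈ s, q.star = true → q.lead ≤ b) :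
    StringSpells (contract b s) p g := by
  induction hs with
  | nil => exact .nil
  | @star Q u s p g hQ hu hs ih =>
    rw [List.append_assoc] at hd
    have ih := ih hd.of_append_right hg fun q hq => hb q (List.mem_cons_of_mem _ hq)
    cases s with
    | nil => exact .star hQ hu hs
    | cons R s =>
      rw [InjectiveWords.contract]
      split_ifs with h
      · cases hs with
        | plain hR => simp [hR] at h
        | @star _ w _ p _ hR hw hs =>
          rw [← List.append_assoc]
          rw [← List.append_assoc, ← List.append_assoc] at hd
          refine .star hQ (hu.diamond hw ?_ hd.of_append_left.of_append_left) hs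
          obtain ⟨t, rfl⟩ := hu.head
          obtain ⟨t', rfl⟩ := hw.head
          refine lt_of_le_of_ne (h.2 ▸ hb Q (by simp) hQ) fun he => ?_
          exact List.disjoint_of_nodup_append hd.of_append_left.of_append_left
            (List.mem_cons_self ..) (he ▸ List.mem_cons_self ..)
      · exact .star hQ hu ih
  | @plain Q u s p g hQ hu hs ih =>
    rw [List.nil_append, List.flatten_cons, List.append_assoc] at hd
    have ih := ih hd.of_append_right (fun c hc => hg c (List.mem_cons_of_mem _ hc))
      fun q hq => hb q (List.mem_cons_of_mem _ hq)
    cases s with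
    | nil => exact .plain hQ hu hs
    | cons R s =>
      rw [InjectiveWords.contract]
      split_ifs with h
      · cases hs with
        | plain hR => simp [hR] at h
        | @star _ w _ p _ hR hw hs =>
          have hg := hg _ (List.mem_cons_self ..)
          rw [← List.append_assoc] at hg ⊢
          rw [← List.append_assoc, ← List.append_assoc] at hd
          refine .plain hQ (hu.diamond hw ?_ hd.of_append_left.of_append_left) hs
          obtain ⟨t, rfl⟩ := hu.head
          obtain ⟨t', rfl⟩ := hw.head
          obtain ⟨a, l, he, hl⟩ := hg
          rw [List.cons_append, List.cons_append, List.cons_eq_cons] at he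
          rw [he.1]
          exact hl _ (by rw [← he.2]; simp)
      · exact .plain hQ hu ih

/-- The matching star is sought in the tail because the head has no left neighbour to merge with. -/
theorem countP_contract {n : ℕ} {b : Fin n} (Q : Quantity n) (s : List (Quantity n))
    (h : ∃ q ∈ s, q.star = true ∧ q.lead = b) :
    (contract b (Q :: s)).countP Quantity.star + 1 = (Q :: s).countP Quantity.star := by
  induction s generalizing Q with
  | nil => simp at h
  | cons R s ih =>
    rw [contract]
    split_ifs with hR
    · simp [List.countP_cons, hR.1]
      omega
    · obtain ⟨q, hq, h⟩ := h
      rcases List.mem_cons.mp hq with rfl | hq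
      · exact absurd h hR
      · rw [List.countP_cons, add_right_comm, ih R ⟨q, hq, h⟩, ← List.countP_cons]

theorem largestStar_eq_none_iff {n : ℕ} {s : List (Quantity n)} :
    largestStar s = none ↔ s.countP Quantity.star = 0 := by
  simp [largestStar, List.max?_eq_none_iff, List.countP_eq_zero]

theorem StringSpells.step {n : ℕ} {s : List (Quantity n)} {g : List (List (Fin n))}
    (hs : StringSpells s [] g) (hd : g.flatten.Nodup) (hg : ∀ c ∈ g, HeadLt c) :
    StringSpells (step s) [] g ∧
      (step s).countP Quantity.star = s.countP Quantity.star - 1 := by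
  rw [InjectiveWords.step]
  cases hb : largestStar s with
  | none =>
    have := largestStar_eq_none_iff.mp hb
    exact ⟨hs, by dsimp only; omega⟩
  | some b =>
    rw [largestStar, List.max?_eq_some_iff] at hb
    refine ⟨hs.contract hd hg fun q hq hqs => hb.2 _ ?_, ?_⟩
    · exact List.mem_map_of_mem (List.mem_filter.mpr ⟨hq, hqs⟩)
    · obtain ⟨q, hq, hqb⟩ := List.mem_map.mp hb.1
      obtain ⟨hq, hqs⟩ := List.mem_filter.mp hq
      -- An empty pending word forces the first quantity to be unstarred, so the star to be
      -- contracted lies in the tail.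
      generalize hp : ([] : List (Fin n)) = p at hs
      cases hs with
      | nil => simp at hq
      | star _ hw _ =>
        obtain ⟨t, rfl⟩ := hw.head
        simp at hp
      | @plain Q _ s _ _ hQ _ _ =>
        refine Nat.eq_sub_of_add_eq (countP_contract Q s ⟨q, ?_, hqs, hqb⟩)
        rcases List.mem_cons.mp hq with rfl | hq
        · simp [hQ] at hqs
        · exact hq

theorem StringSpells.iterate_step {n : ℕ} {s : List (Quantity n)} {g : List (List (Fin n))}
    (hs : StringSpells s [] g) (hd : g.flatten.Nodup) (hg : ∀ c ∈ g, HeadLt c) (k : ℕ) :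
    StringSpells (InjectiveWords.step^[k] s) [] g ∧
      (InjectiveWords.step^[k] s).countP Quantity.star = s.countP Quantity.star - k := by
  induction k with
  | zero => exact ⟨hs, rfl⟩
  | succ k ih =>
    rw [Function.iterate_succ_apply']
    obtain ⟨h1, h2⟩ := ih.1.step hd hg
    exact ⟨h1, by omega⟩

theorem StringSpells.forall₂ {n : ℕ} {s : List (Quantity n)} {p : List (Fin n)}
    {g : List (List (Fin n))} (hs : StringSpells s p g) (h0 : s.countP Quantity.star = 0) :
    List.Forall₂ Quantity.Spells s g ∧ p = [] := by
  induction hs with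
  | nil => exact ⟨.nil, rfl⟩
  | star hq => simp [hq] at h0
  | plain hq hw _ ih =>
    obtain ⟨h1, rfl⟩ := ih (by simpa [hq] using h0)
    rw [List.append_nil]
    exact ⟨.cons hw h1, rfl⟩

theorem stringSpells_flatMap_cycleString {n : ℕ} (g : List (List (Fin n))) (hg : ∀ c ∈ g, c ≠ []) :
    StringSpells (g.flatMap cycleString) [] g := by
  induction g with
  | nil => exact .nil
  | cons c g ih =>
    have ih := ih fun c hc => hg c (List.mem_cons_of_mem _ hc)
    rw [List.flatMap_cons]
    cases c with
    | nil => exact absurd rfl (hg [] (List.mem_cons_self ..))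
    | cons a l =>
      refine .plain (w := [a]) rfl (Quantity.spells_letter _ _) ?_
      clear hg
      induction l with
      | nil => exact ih
      | cons b l ihl => exact .star (w := [b]) rfl (Quantity.spells_letter _ _) ihl

theorem length_flatMap_cycleString {n : ℕ} (g : List (List (Fin n))) :
    (g.flatMap cycleString).length = g.flatten.length := by
  induction g with
  | nil => rfl
  | cons c g ih =>
    rw [List.flatMap_cons, List.flatten_cons, List.length_append, List.length_append, ih]
    cases c <;> simp [cycleString]

theorem leadsTo_foldr {n : ℕ} {s : List (Quantity n)} {g : List (List (Fin n))}
    (hs : List.Forall₂ Quantity.Spells s g) (hd : g.flatten.Nodup) :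
    LeadsTo (s.foldr (fun q y => concat q.chain y) (Finsupp.single (emptyWord n) 1))
      g.reverse.flatten := by
  induction hs with
  | nil =>
    refine ⟨fun v hv => ?_, fun v hv => ?_, emptyWord n, rfl, by simp⟩ <;>
    · have := Finset.mem_singleton.mp (Finsupp.support_single_subset hv)
      simp [this, emptyWord]
  | @cons q w s g hq _ ih =>
    rw [List.flatten_cons] at hd
    have hp : ((w :: g).reverse.flatten).Perm (w :: g).flatten := (List.reverse_perm _).flatten
    rw [List.reverse_cons, List.flatten_concat] at hp ⊢
    exact hq.leadsTo.concat (ih hd.of_append_right) (hp.nodup_iff.mpr hd)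

theorem deletion_foldr_eq_zero {n : ℕ} {s : List (Quantity n)} {g : List (List (Fin n))}
    (hs : List.Forall₂ Quantity.Spells s g) (hd : g.flatten.Nodup)
    (hg : ∀ c ∈ g, 2 ≤ c.length) {a : Fin n} (ha : a ∈ g.flatten) :
    deletion a
      (s.foldr (fun q y => concat q.chain y) (Finsupp.single (emptyWord n) 1)) = 0 := by
  induction hs with
  | nil => simp at ha
  | @cons q w s g hq hs ih =>
    rw [List.flatten_cons] at hd ha
    have hdis := List.disjoint_of_nodup_append hd
    rw [List.foldr_cons]
    rcases List.mem_append.mp ha with h | h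
    · rw [deletion_concat_left, hq.deletion_eq_zero (hg w (List.mem_cons_self ..)) a h]
      · simp
      · intro v hv hav
        refine hdis h ?_
        have := ((leadsTo_foldr hs hd.of_append_right).perm v hv).mem_iff.mp hav
        simpa using this
    · rw [deletion_concat_right, ih hd.of_append_right
        (fun c hc => hg c (List.mem_cons_of_mem _ hc)) h, map_zero]
      exact fun v hv hav => hdis ((hq.leadsTo.perm v hv).mem_iff.mp hav) h

/-! ### The standard cycle form -/

theorem mem_standardCycleForm {n : ℕ} {τ : Equiv.Perm (Fin n)} {c : List (Fin n)} :
    c ∈ standardCycleForm τ ↔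
      ∃ a, (τ a ≠ a ∧ ∀ b, τ.SameCycle a b → a ≤ b) ∧ τ.toList a = c := by
  simp [standardCycleForm]

theorem two_le_length_of_mem_standardCycleForm {n : ℕ} {τ : Equiv.Perm (Fin n)}
    {c : List (Fin n)} (hc : c ∈ standardCycleForm τ) : 2 ≤ c.length := by
  obtain ⟨a, ⟨ha, -⟩, rfl⟩ := mem_standardCycleForm.mp hc
  exact Equiv.Perm.two_le_length_toList_iff_mem_support.mpr (Equiv.Perm.mem_support.mpr ha)

theorem exists_toList_eq_cons {n : ℕ} {τ : Equiv.Perm (Fin n)} {a : Fin n} (ha : τ a ≠ a) :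
    ∃ t, τ.toList a = a :: t := by
  have h := Equiv.Perm.toList_getElem_zero τ a (Equiv.Perm.mem_support.mpr ha)
  cases hl : τ.toList a with
  | nil => exact absurd (Equiv.Perm.mem_support.mpr ha) (Equiv.Perm.toList_eq_nil_iff.mp hl)
  | cons b t =>
    simp only [hl, List.getElem_cons_zero] at h
    exact ⟨t, by rw [h]⟩

theorem toList_eq_cons_of_isMin {n : ℕ} {τ : Equiv.Perm (Fin n)} {a : Fin n} (ha : τ a ≠ a)
    (hmin : ∀ b, τ.SameCycle a b → a ≤ b) : ∃ t, τ.toList a = a :: t ∧ ∀ b ∈ t, a < b := by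
  obtain ⟨t, ht⟩ := exists_toList_eq_cons ha
  refine ⟨t, ht, fun b hb => ?_⟩
  have hn := τ.nodup_toList a
  rw [ht, List.nodup_cons] at hn
  have hb' : b ∈ τ.toList a := ht ▸ List.mem_cons_of_mem _ hb
  exact lt_of_le_of_ne (hmin b (Equiv.Perm.mem_toList_iff.mp hb').1) fun e => hn.1 (e ▸ hb)

theorem headLt_of_mem_standardCycleForm {n : ℕ} {τ : Equiv.Perm (Fin n)} {c : List (Fin n)}
    (hc : c ∈ standardCycleForm τ) : HeadLt c := by
  obtain ⟨a, ⟨ha, hmin⟩, rfl⟩ := mem_standardCycleForm.mp hc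
  obtain ⟨t, ht⟩ := toList_eq_cons_of_isMin ha hmin
  exact ⟨a, t, ht⟩

theorem mem_flatten_standardCycleForm {n : ℕ} {τ : Equiv.Perm (Fin n)} {b : Fin n} :
    b ∈ (standardCycleForm τ).flatten ↔ τ b ≠ b := by
  rw [List.mem_flatten]
  constructor
  · rintro ⟨c, hc, hb⟩
    obtain ⟨a, ⟨ha, -⟩, rfl⟩ := mem_standardCycleForm.mp hc
    exact fun h => ha ((Equiv.Perm.mem_toList_iff.mp hb).1.apply_eq_self_iff.mpr h)
  · intro hb
    obtain ⟨a, ha, hmin⟩ := Finset.exists_min_image (Finset.univ.filter fun x => τ.SameCycle b x)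
      id ⟨b, by simp [Equiv.Perm.SameCycle.refl]⟩
    simp only [Finset.mem_filter, Finset.mem_univ, true_and, id] at ha hmin
    have ha' : τ a ≠ a := fun h => hb (ha.apply_eq_self_iff.mpr h)
    exact ⟨_, mem_standardCycleForm.mpr ⟨a, ⟨ha', fun x hx => hmin x (ha.trans hx)⟩, rfl⟩,
      Equiv.Perm.mem_toList_iff.mpr ⟨ha.symm, Equiv.Perm.mem_support.mpr ha'⟩⟩

theorem nodup_flatten_standardCycleForm {n : ℕ} (τ : Equiv.Perm (Fin n)) :
    (standardCycleForm τ).flatten.Nodup := by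
  rw [List.nodup_flatten]
  constructor
  · intro c hc
    obtain ⟨a, -, rfl⟩ := mem_standardCycleForm.mp hc
    exact τ.nodup_toList a
  · rw [standardCycleForm, List.pairwise_map]
    refine ((List.nodup_finRange n).filter _).pairwise_of_forall_ne fun a ha b hb hab x hxa hxb => ?_
    rw [List.mem_filter, decide_eq_true_iff] at ha hb
    rw [Equiv.Perm.mem_toList_iff] at hxa hxb
    have h := hxa.1.trans hxb.1.symm
    exact hab (le_antisymm (ha.2.2 b h) (hb.2.2 a h.symm))

theorem pairwise_standardCycleForm {n : ℕ} (τ : Equiv.Perm (Fin n)) :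
    (standardCycleForm τ).Pairwise fun c d => ∀ a ∈ c.head?, ∀ b ∈ d.head?, a < b := by
  rw [standardCycleForm, List.pairwise_map]
  have h := (List.pairwise_lt_finRange n).filter fun a => τ a ≠ a ∧ ∀ b, τ.SameCycle a b → a ≤ b
  refine h.imp_of_mem fun {a b} ha hb hab => ?_
  rw [List.mem_filter, decide_eq_true_iff] at ha hb
  obtain ⟨t, ht⟩ := exists_toList_eq_cons ha.2.1
  obtain ⟨t', ht'⟩ := exists_toList_eq_cons hb.2.1
  simpa [ht, ht'] using hab

/-- A moved point lies in a listed cycle, and `formPerm` of that list gives its image back. -/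
theorem standardCycleForm_injective (n : ℕ) :
    Function.Injective (standardCycleForm : Equiv.Perm (Fin n) → _) := by
  have key : ∀ τ τ' : Equiv.Perm (Fin n), standardCycleForm τ = standardCycleForm τ' →
      ∀ x, τ x ≠ x → τ x = τ' x := by
    intro τ τ' h x hx
    obtain ⟨c, hc, hxc⟩ := List.mem_flatten.mp (mem_flatten_standardCycleForm.mpr hx)
    have hc' := hc
    rw [h] at hc'
    obtain ⟨a, -, rfl⟩ := mem_standardCycleForm.mp hc
    obtain ⟨a', -, ha'⟩ := mem_standardCycleForm.mp hc'
    have hx' := hxc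
    rw [← ha'] at hx'
    have h1 := congrArg (fun l => List.formPerm l x) ha'
    simp only [Equiv.Perm.formPerm_toList] at h1
    rwa [(Equiv.Perm.mem_toList_iff.mp hxc).1.cycleOf_apply,
      (Equiv.Perm.mem_toList_iff.mp hx').1.cycleOf_apply, eq_comm] at h1
  intro τ τ' h
  ext1 x
  by_cases hx : τ x = x
  · by_cases hx' : τ' x = x
    · rw [hx, hx']
    · exact (key τ' τ h.symm x hx').symm
  · exact key τ τ' h x hx

/-- The inverse of Foata's correspondence: the block headed by `a` ends just before the first later
letter below `a`, so the cuts can be read off the concatenation. -/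
theorem eq_of_flatten_eq {n : ℕ} {g g' : List (List (Fin n))} (hg : ∀ c ∈ g, HeadLt c)
    (hg' : ∀ c ∈ g', HeadLt c)
    (hp : g.Pairwise fun c d => ∀ a ∈ c.head?, ∀ b ∈ d.head?, b < a)
    (hp' : g'.Pairwise fun c d => ∀ a ∈ c.head?, ∀ b ∈ d.head?, b < a)
    (h : g.flatten = g'.flatten) : g = g' := by
  have key : ∀ (a : Fin n) (t : List (Fin n)) (g : List (List (Fin n))), (∀ b ∈ t, a < b) →
      (∀ c ∈ g, HeadLt c) → (∀ d ∈ g, ∀ b ∈ d.head?, b < a) →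
      (t ++ g.flatten).takeWhile (fun b => a < b) = t := by
    intro a t g ht hg hlt
    rw [List.takeWhile_append_of_pos (by simpa using ht)]
    cases g with
    | nil => simp
    | cons d g =>
      obtain ⟨b, l, rfl, -⟩ := hg d (List.mem_cons_self ..)
      have := hlt _ (List.mem_cons_self ..) b (by simp)
      rw [List.flatten_cons, List.cons_append, List.takeWhile_cons_of_neg (by simpa using this.le),
        List.append_nil]
  induction g generalizing g' with
  | nil =>
    cases g' with
    | nil => rfl
    | cons d g' =>
      obtain ⟨b, l, rfl, -⟩ := hg' d (List.mem_cons_self ..)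
      simp at h
  | cons c g ih =>
    obtain ⟨a, t, rfl, ht⟩ := hg c (List.mem_cons_self ..)
    cases g' with
    | nil => simp at h
    | cons d g' =>
      obtain ⟨b, l, rfl, hl⟩ := hg' d (List.mem_cons_self ..)
      rw [List.flatten_cons, List.flatten_cons, List.cons_append, List.cons_append,
        List.cons_eq_cons] at h
      obtain ⟨rfl, h⟩ := h
      rw [List.pairwise_cons] at hp hp'
      have hg1 := fun c hc => hg c (List.mem_cons_of_mem _ hc)
      have hg1' := fun c hc => hg' c (List.mem_cons_of_mem _ hc)
      have h1 := key a t g ht hg1 fun d hd => hp.1 d hd a rfl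
      have h2 := key a l g' hl hg1' fun d hd => hp'.1 d hd a rfl
      have htl : t = l := by rw [← h1, h, h2]
      subst htl
      rw [ih hg1 hg1' hp.2 hp'.2 (List.append_cancel_left h)]

/-! ### The wavelet chains -/

theorem exists_forall₂_spells {n : ℕ} (τ : Equiv.Perm (Fin n)) :
    List.Forall₂ Quantity.Spells (step^[n] (initialString τ)) (standardCycleForm τ) := by
  have hd := nodup_flatten_standardCycleForm τ
  have h := (stringSpells_flatMap_cycleString (standardCycleForm τ) fun c hc h => by
    have := two_le_length_of_mem_standardCycleForm hc
    simp [h] at this).iterate_step hd (fun c hc => headLt_of_mem_standardCycleForm hc) n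
  refine (h.1.forall₂ ?_).1
  -- The string has one entry per letter moved by `τ`, so `n` rounds exhaust the stars.
  have h1 : ((standardCycleForm τ).flatMap cycleString).countP Quantity.star ≤ n := by
    refine List.countP_le_length.trans ?_
    rw [length_flatMap_cycleString]
    simpa using hd.length_le_card
  exact h.2.trans (Nat.sub_eq_zero_of_le h1)

theorem leadsTo_waveletChain {n : ℕ} (τ : Equiv.Perm (Fin n)) :
    LeadsTo (waveletChain τ) (standardCycleForm τ).reverse.flatten :=
  leadsTo_foldr (exists_forall₂_spells τ) (nodup_flatten_standardCycleForm τ)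

theorem linearIndependent_waveletChain (n : ℕ) :
    LinearIndependent ℝ (waveletChain : Equiv.Perm (Fin n) → Chain n) := by
  refine linearIndependent_of_leadsTo leadsTo_waveletChain fun τ τ' h => ?_
  refine standardCycleForm_injective n (List.reverse_injective (eq_of_flatten_eq ?_ ?_ ?_ ?_ h))
  · exact fun c hc => headLt_of_mem_standardCycleForm (List.mem_reverse.mp hc)
  · exact fun c hc => headLt_of_mem_standardCycleForm (List.mem_reverse.mp hc)
  · exact List.pairwise_reverse.mpr
      ((pairwise_standardCycleForm τ).imp fun h a ha b hb => h b hb a ha)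
  · exact List.pairwise_reverse.mpr
      ((pairwise_standardCycleForm τ').imp fun h a ha b hb => h b hb a ha)

theorem waveletChain_mem_H {n : ℕ} (τ : Equiv.Perm (Fin n)) : waveletChain τ ∈ H τ.support := by
  refine Submodule.mem_inf.mpr ⟨(Finsupp.mem_supported _ _).mpr fun v hv => ?_, ?_⟩
  · ext b
    have := ((leadsTo_waveletChain τ).perm v hv).mem_iff (a := b)
    rw [content, List.mem_toFinset, this, Equiv.Perm.mem_support,
      ← mem_flatten_standardCycleForm]
    simp
  · simp only [Submodule.mem_iInf, LinearMap.mem_ker]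
    exact fun a ha => deletion_foldr_eq_zero (exists_forall₂_spells τ)
      (nodup_flatten_standardCycleForm τ) (fun c hc => two_le_length_of_mem_standardCycleForm hc)
      (mem_flatten_standardCycleForm.mpr (Equiv.Perm.mem_support.mp ha))

theorem waveletChain_one (n : ℕ) :
    waveletChain (1 : Equiv.Perm (Fin n)) = Finsupp.single (emptyWord n) 1 := by
  have h := exists_forall₂_spells (1 : Equiv.Perm (Fin n))
  have h0 : standardCycleForm (1 : Equiv.Perm (Fin n)) = [] := by simp [standardCycleForm]
  rw [h0, List.forall₂_nil_right_iff] at h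
  rw [waveletChain, h, List.foldr_nil]

/-! ### Marginals and the independence of the spaces `W A` -/

/-- The sum of `f` over the permutations whose word induces the word `l` on the set `B`. -/
noncomputable def marginal {n : ℕ} (B : Finset (Fin n)) (l : List (Fin n)) :
    PermFn n →ₗ[ℝ] ℝ :=
  ∑ σ ∈ Finset.univ.filter (fun σ : Equiv.Perm (Fin n) =>
    (permWord σ).1.filter (fun b => b ∈ B) = l), LinearMap.proj σ

theorem embedding_single {n : ℕ} (w : InjWord n) :
    embedding n (Finsupp.single w 1) = (permsContaining w).indicator fun _ => (1 : ℝ) := by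
  simp [embedding]

theorem embedding_emptyWord (n : ℕ) :
    embedding n (Finsupp.single (emptyWord n) 1) = fun _ => 1 := by
  rw [embedding_single]
  funext σ
  exact Set.indicator_of_mem (show σ ∈ permsContaining (emptyWord n) from List.nil_infix) _

theorem permWord_mul_inv {n : ℕ} (σ g : Equiv.Perm (Fin n)) :
    (permWord (σ * g⁻¹)).1 = (permWord σ).1.map g := by
  simp only [permWord, List.map_ofFn]
  rfl

open Classical in
theorem marginal_embedding_single {n : ℕ} (B : Finset (Fin n)) (l : List (Fin n)) (w : InjWord n) :
    marginal B l (embedding n (Finsupp.single w 1)) = ∑ σ : Equiv.Perm (Fin n),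
      if (permWord σ).1.filter (fun b => b ∈ B) = l ∧ σ ∈ permsContaining w
        then (1 : ℝ) else 0 := by
  rw [embedding_single, marginal, LinearMap.sum_apply, Finset.sum_filter]
  refine Finset.sum_congr rfl fun σ _ => ?_
  by_cases h1 : (permWord σ).1.filter (fun b => b ∈ B) = l <;>
    by_cases h2 : σ ∈ permsContaining w <;> simp [h1, h2]

theorem exists_perm_map_eq {n : ℕ} {v w : List (Fin n)} (hv : v.Nodup) (h : v.Perm w) :
    ∃ g : Equiv.Perm (Fin n), v.map g = w ∧ ∀ x, x ∉ v → g x = x := by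
  induction h with
  | nil => exact ⟨1, rfl, fun _ _ => rfl⟩
  | @cons a v w _ ih =>
    rw [List.nodup_cons] at hv
    obtain ⟨g, hg, hfix⟩ := ih hv.2
    exact ⟨g, by rw [List.map_cons, hg, hfix a hv.1],
      fun x hx => hfix x fun hx' => hx (List.mem_cons_of_mem _ hx')⟩
  | swap a b v =>
    refine ⟨Equiv.swap a b, ?_, fun x hx => ?_⟩
    · simp only [List.nodup_cons, List.mem_cons, not_or] at hv
      rw [List.map_cons, List.map_cons, Equiv.swap_apply_right, Equiv.swap_apply_left,
        List.map_congr_left (g := id), List.map_id]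
      intro x hx
      exact Equiv.swap_apply_of_ne_of_ne (fun e => hv.2.1 (e ▸ hx)) fun e => hv.1.2 (e ▸ hx)
    · simp only [List.mem_cons, not_or] at hx
      exact Equiv.swap_apply_of_ne_of_ne hx.2.1 hx.1
  | @trans u v w huv hvw ih1 ih2 =>
    obtain ⟨g, hg, hfix⟩ := ih1 hv
    obtain ⟨g', hg', hfix'⟩ := ih2 (huv.nodup_iff.mp hv)
    refine ⟨g' * g, ?_, fun x hx => ?_⟩
    · rw [Equiv.Perm.coe_mul, ← List.map_map, hg, hg']
    · rw [Equiv.Perm.mul_apply, hfix x hx, hfix' x fun h => hx (huv.mem_iff.mpr h)]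

/-- Relabel by a permutation `g` of the letters taking `v` to `w` and fixing all others. Then `σ ↦ σ
* g⁻¹` replaces the block `v` by `w` in place, which does not change the word induced on `B`. -/
theorem marginal_embedding_single_congr {n : ℕ} {B : Finset (Fin n)} (l : List (Fin n))
    {v w : InjWord n} (hp : v.1.Perm w.1)
    (hf : v.1.filter (fun b => b ∈ B) = w.1.filter (fun b => b ∈ B)) :
    marginal B l (embedding n (Finsupp.single v 1)) =
      marginal B l (embedding n (Finsupp.single w 1)) := by
  obtain ⟨g, hg, hfix⟩ := exists_perm_map_eq v.2 hp
  have hmap : ∀ u : List (Fin n), u.Disjoint v.1 → u.map g = u := fun u hu => by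
    rw [List.map_congr_left (g := id), List.map_id]
    exact fun x hx => hfix x (hu hx)
  have key : ∀ σ, σ ∈ permsContaining v → σ * g⁻¹ ∈ permsContaining w ∧
      (permWord (σ * g⁻¹)).1.filter (fun b => b ∈ B) =
        (permWord σ).1.filter (fun b => b ∈ B) := by
    rintro σ ⟨s, t, hσ⟩
    have hn := (permWord σ).2
    rw [← hσ] at hn
    have hs : s.map g = s := hmap s (List.disjoint_of_nodup_append hn.of_append_left)
    have ht : t.map g = t := hmap t fun x hx hx' =>
      List.disjoint_of_nodup_append hn (List.mem_append_right _ hx') hx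
    have h : (permWord (σ * g⁻¹)).1 = s ++ w.1 ++ t := by
      rw [permWord_mul_inv, ← hσ, List.map_append, List.map_append, hg, hs, ht]
    exact ⟨⟨s, t, h.symm⟩, by rw [h, ← hσ]; simp only [List.filter_append, hf]⟩
  have key' : ∀ σ, σ * g⁻¹ ∈ permsContaining w → σ ∈ permsContaining v := by
    rintro σ ⟨s, t, hσ⟩
    rw [permWord_mul_inv, ← hg] at hσ
    refine ⟨s.map g.symm, t.map g.symm, ?_⟩
    have := congrArg (List.map g.symm) hσ
    simpa [List.map_map, Function.comp_def] using this
  classical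
  rw [marginal_embedding_single, marginal_embedding_single]
  refine Fintype.sum_equiv (Equiv.mulRight g⁻¹) _ _ fun σ => ?_
  rw [Equiv.coe_mulRight]
  refine if_congr ⟨fun h => ?_, fun h => ?_⟩ rfl rfl
  · obtain ⟨h1, h2⟩ := key σ h.2
    exact ⟨h2.trans h.1, h1⟩
  · have h1 := key' σ h.2
    exact ⟨(key σ h1).2.symm.trans h.1, h1⟩

theorem marginal_embedding_eq_sum {n : ℕ} (B : Finset (Fin n)) (l : List (Fin n)) (x : Chain n) :
    marginal B l (embedding n x) =
      x.sum fun w r => r * marginal B l (embedding n (Finsupp.single w 1)) := by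
  conv_lhs => rw [← Finsupp.sum_single x]
  simp only [Finsupp.sum, map_sum]
  refine Finset.sum_congr rfl fun w _ => ?_
  rw [← mul_one (x w), ← smul_eq_mul (x w) (1 : ℝ), ← Finsupp.smul_single, map_smul, map_smul,
    smul_eq_mul, smul_eq_mul, mul_one]

/-- For `a ∈ A \ B`, the marginal does not see where `a` stands in a word, so on `x` it factors
through `deletion a`, which kills `x`. -/
theorem marginal_embedding_eq_zero {n : ℕ} {A B : Finset (Fin n)} (l : List (Fin n)) {x : Chain n}
    (hx : x ∈ H A) (hAB : ¬A ⊆ B) : marginal B l (embedding n x) = 0 := by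
  classical
  obtain ⟨a, haA, haB⟩ := Finset.not_subset.mp hAB
  obtain ⟨hs, hk⟩ := Submodule.mem_inf.mp hx
  simp only [Submodule.mem_iInf, LinearMap.mem_ker] at hk
  -- `G` puts `a` back in front before taking the marginal; the value `0` on words already
  -- containing `a` is never used.
  let G : Chain n →ₗ[ℝ] ℝ := Finsupp.linearCombination ℝ fun v : InjWord n =>
    if h : a ∉ v.1 then
      marginal B l (embedding n (Finsupp.single ⟨a :: v.1, List.nodup_cons.mpr ⟨h, v.2⟩⟩ 1))
    else 0
  have hG : G (deletion a x) = marginal B l (embedding n x) := by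
    rw [marginal_embedding_eq_sum]
    conv_lhs => rw [← Finsupp.sum_single x]
    simp only [Finsupp.sum, map_sum]
    refine Finset.sum_congr rfl fun w hw => ?_
    have hwA : content w = A := (Finsupp.mem_supported _ _).mp hs hw
    have haw : a ∈ w.1 := by
      rw [← hwA] at haA
      simpa [content] using haA
    have han : a ∉ (deleteLetter a w).1 := w.2.not_mem_erase
    rw [deletion_single, Finsupp.linearCombination_single, dif_pos han, smul_eq_mul]
    congr 1
    have hpe : (a :: w.1.erase a).Perm w.1 := (List.perm_cons_erase haw).symm
    refine marginal_embedding_single_congr l hpe ?_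
    simp only [deleteLetter]
    rw [List.filter_cons_of_neg (by simpa using haB)]
    rw [w.2.erase_eq_filter, List.filter_filter]
    refine List.filter_congr fun b _ => ?_
    by_cases hb : b ∈ B
    · have : b ≠ a := fun e => haB (e ▸ hb)
      simp [hb, this]
    · simp [hb]
  rw [← hG, hk a haA, map_zero]

theorem exists_permWord_eq {n : ℕ} {l : List (Fin n)} (hl : l.Nodup) (hlen : l.length = n) :
    ∃ σ : Equiv.Perm (Fin n), (permWord σ).1 = l := by
  have hb : Function.Bijective fun i : Fin n => l.get (Fin.cast hlen.symm i) :=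
    Finite.injective_iff_bijective.mp fun i j hij => by
      simpa using List.nodup_iff_injective_get.mp hl hij
  refine ⟨(Equiv.ofBijective _ hb).symm, ?_⟩
  refine List.ext_getElem (by simp [permWord, hlen]) fun i h1 h2 => ?_
  simp [permWord]

theorem permsContaining_nonempty {n : ℕ} (w : InjWord n) : (permsContaining w).Nonempty := by
  classical
  let r : List (Fin n) := (List.finRange n).filter fun b => b ∉ w.1
  have hn : (w.1 ++ r).Nodup := by
    refine w.2.append ((List.nodup_finRange n).filter _) fun a ha ha' => ?_
    simp [r, ha] at ha'
  have hlen : (w.1 ++ r).length = n := by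
    rw [← List.toFinset_card_of_nodup hn]
    have : (w.1 ++ r).toFinset = Finset.univ := by
      ext b
      by_cases hb : b ∈ w.1 <;> simp [r, hb]
    rw [this, Finset.card_univ, Fintype.card_fin]
  obtain ⟨σ, hσ⟩ := exists_permWord_eq hn hlen
  exact ⟨σ, [], r, by rw [hσ, List.nil_append]⟩

theorem filter_permWord_of_mem_permsContaining {n : ℕ} {w : InjWord n} {σ : Equiv.Perm (Fin n)}
    (h : σ ∈ permsContaining w) :
    (permWord σ).1.filter (fun b => b ∈ content w) = w.1 := by
  obtain ⟨s, t, hσ⟩ := h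
  have hn := (permWord σ).2
  rw [← hσ] at hn
  have hs : s.filter (fun b => b ∈ content w) = [] := by
    rw [List.filter_eq_nil_iff]
    intro a ha
    simpa [content] using List.disjoint_of_nodup_append hn.of_append_left ha
  have ht : t.filter (fun b => b ∈ content w) = [] := by
    rw [List.filter_eq_nil_iff]
    intro a ha
    have : a ∉ w.1 := fun h =>
      List.disjoint_of_nodup_append hn (List.mem_append_right _ h) ha
    simpa [content] using this
  have hw : w.1.filter (fun b => b ∈ content w) = w.1 := by
    rw [List.filter_eq_self]
    intro a ha
    simpa [content] using ha
  rw [← hσ, List.filter_append, List.filter_append, hs, ht, hw, List.nil_append, List.append_nil]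

/-- A permutation containing a word of content `A` induces exactly that word on `A`, so the marginal
at `w` is `x w` times the positive number of permutations containing `w`. -/
theorem eq_zero_of_marginal_embedding_eq_zero {n : ℕ} {A : Finset (Fin n)} {x : Chain n}
    (hx : x ∈ H A) (h : ∀ l, marginal A l (embedding n x) = 0) : x = 0 := by
  classical
  have hs := (Finsupp.mem_supported _ _).mp (Submodule.mem_inf.mp hx).1
  by_contra hne
  obtain ⟨w, hw⟩ := Finsupp.support_nonempty_iff.mpr hne
  have hwA : content w = A := hs hw
  have h0 := h w.1
  rw [marginal_embedding_eq_sum, Finsupp.sum, Finset.sum_eq_single w] at h0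
  · refine (mul_ne_zero (Finsupp.mem_support_iff.mp hw) (ne_of_gt ?_)) h0
    rw [marginal_embedding_single]
    obtain ⟨σ, hσ⟩ := permsContaining_nonempty w
    refine Finset.sum_pos' (fun σ _ => by split_ifs <;> norm_num) ⟨σ, Finset.mem_univ _, ?_⟩
    rw [if_pos ⟨hwA ▸ filter_permWord_of_mem_permsContaining hσ, hσ⟩]
    exact one_pos
  · intro v hv hvw
    have hvA : content v = A := hs hv
    rw [marginal_embedding_single, Finset.sum_eq_zero, mul_zero]
    intro σ _
    refine if_neg fun hσ => hvw (Subtype.ext ?_)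
    rw [← filter_permWord_of_mem_permsContaining hσ.2, hvA, hσ.1]
  · exact fun hw' => absurd hw hw'

/-- In the marginal on `A`, proper subsets of `A` contribute nothing by induction, and sets not
contained in `A` nothing by `marginal_embedding_eq_zero`; only `x A` remains. -/
theorem eq_zero_of_embedding_sum_eq_zero {n : ℕ} {x : Finset (Fin n) → Chain n}
    (hx : ∀ A, x A ∈ H A) (h : embedding n (∑ A, x A) = 0) (A : Finset (Fin n)) : x A = 0 := by
  classical
  induction A using Finset.strongInduction with
  | H A ih =>
    refine eq_zero_of_marginal_embedding_eq_zero (hx A) fun l => ?_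
    have h1 := congrArg (marginal A l) h
    rw [map_sum, map_sum, map_zero, Finset.sum_eq_single A] at h1
    · exact h1
    · intro B _ hBA
      by_cases hB : B ⊆ A
      · rw [ih B (hB.ssubset_of_ne hBA), map_zero, map_zero]
      · exact marginal_embedding_eq_zero l (hx B) hB
    · simp

/-! ### The wavelet basis -/

/-- The identity is no exception: its chain is the empty word, contained in every permutation. -/
theorem wavelet_eq_embedding {n : ℕ} (τ : Equiv.Perm (Fin n)) :
    wavelet τ = embedding n (waveletChain τ) := by
  rw [wavelet]
  split_ifs with h
  · rw [h, waveletChain_one, embedding_emptyWord]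
  · rfl

theorem sum_smul_waveletChain_mem_H {n : ℕ} (c : Equiv.Perm (Fin n) → ℝ) (A : Finset (Fin n)) :
    ∑ τ with τ.support = A, c τ • waveletChain τ ∈ H A :=
  Submodule.sum_mem _ fun τ hτ =>
    Submodule.smul_mem _ _ ((Finset.mem_filter.mp hτ).2 ▸ waveletChain_mem_H τ)

theorem embedding_sum_fiberwise {n : ℕ} (c : Equiv.Perm (Fin n) → ℝ) :
    embedding n (∑ A : Finset (Fin n), ∑ τ with τ.support = A, c τ • waveletChain τ) =
      ∑ τ, c τ • wavelet τ := by
  rw [Finset.sum_fiberwise, map_sum]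
  exact Finset.sum_congr rfl fun τ _ => by rw [map_smul, wavelet_eq_embedding]

theorem linearIndependent_wavelet (n : ℕ) :
    LinearIndependent ℝ (wavelet : Equiv.Perm (Fin n) → PermFn n) := by
  rw [Fintype.linearIndependent_iff]
  intro c hc
  rw [← embedding_sum_fiberwise] at hc
  have h := eq_zero_of_embedding_sum_eq_zero (sum_smul_waveletChain_mem_H c) hc
  refine Fintype.linearIndependent_iff.mp (linearIndependent_waveletChain n) c ?_
  rw [← Finset.sum_fiberwise Finset.univ Equiv.Perm.support]
  exact Finset.sum_eq_zero fun A _ => h A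

/-- The basis of `L(S_n)` formed by the wavelet functions. -/
noncomputable def waveletBasis (n : ℕ) : Module.Basis (Equiv.Perm (Fin n)) ℝ (PermFn n) :=
  basisOfLinearIndependentOfCardEqFinrank (linearIndependent_wavelet n)
    (Module.finrank_fintype_fun_eq_card ℝ).symm

theorem waveletBasis_apply {n : ℕ} (τ : Equiv.Perm (Fin n)) : waveletBasis n τ = wavelet τ := by
  simp [waveletBasis]

theorem wavelet_mem_W {n : ℕ} (τ : Equiv.Perm (Fin n)) : wavelet τ ∈ W τ.support :=
  ⟨_, waveletChain_mem_H τ, (wavelet_eq_embedding τ).symm⟩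

theorem W_le_span_wavelet {n : ℕ} (A : Finset (Fin n)) :
    W A ≤ Submodule.span ℝ
      (Set.range fun τ : {τ : Equiv.Perm (Fin n) // τ.support = A} => wavelet τ.1) := by
  rintro _ ⟨y, hy, rfl⟩
  let c := (waveletBasis n).repr (embedding n y)
  -- Expand `embedding n y` in the wavelet basis, group the terms by support and subtract `y` at
  -- `A`: the components must all vanish, so `y` uses only the chains of support `A`.
  let z : Finset (Fin n) → Chain n := fun B =>
    (∑ τ with τ.support = B, c τ • waveletChain τ) - if B = A then y else 0
  have hz : ∀ B, z B ∈ H B := by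
    intro B
    refine Submodule.sub_mem _ (sum_smul_waveletChain_mem_H c B) ?_
    split_ifs with h
    · exact h ▸ hy
    · exact Submodule.zero_mem _
  have hsum : embedding n (∑ B, z B) = 0 := by
    rw [Finset.sum_sub_distrib, map_sub, embedding_sum_fiberwise, Finset.sum_ite_eq',
      if_pos (Finset.mem_univ A), sub_eq_zero]
    simp only [← waveletBasis_apply]
    exact (waveletBasis n).sum_repr _
  have h := eq_zero_of_embedding_sum_eq_zero hz hsum A
  have hyA : y = ∑ τ with τ.support = A, c τ • waveletChain τ := by
    have : (∑ τ with τ.support = A, c τ • waveletChain τ) - (if A = A then y else 0) = 0 := h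
    rw [if_pos rfl, sub_eq_zero] at this
    exact this.symm
  rw [hyA, map_sum]
  refine Submodule.sum_mem _ fun τ hτ => ?_
  rw [map_smul, ← wavelet_eq_embedding]
  exact Submodule.smul_mem _ _
    (Submodule.subset_span ⟨⟨τ, (Finset.mem_filter.mp hτ).2⟩, rfl⟩)

theorem exists_basis_W {n : ℕ} (A : Finset (Fin n)) :
    ∃ b : Module.Basis {τ : Equiv.Perm (Fin n) // τ.support = A} ℝ (W A),
      ∀ τ, (b τ : PermFn n) = wavelet τ.1 := by
  let v : {τ : Equiv.Perm (Fin n) // τ.support = A} → W A :=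
    fun τ => ⟨wavelet τ.1, (congrArg W τ.2).le (wavelet_mem_W τ.1)⟩
  have hv : LinearIndependent ℝ v :=
    .of_comp (W A).subtype ((linearIndependent_wavelet n).comp _ Subtype.val_injective)
  have hs : ⊤ ≤ Submodule.span ℝ (Set.range v) := by
    rintro ⟨f, hf⟩ -
    have h := W_le_span_wavelet A hf
    have hr : (Set.range fun τ : {τ : Equiv.Perm (Fin n) // τ.support = A} => wavelet τ.1) =
        (W A).subtype '' Set.range v := by
      rw [← Set.range_comp]
      rfl
    rw [hr, ← Submodule.map_span] at h
    obtain ⟨g, hg, rfl⟩ := h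
    exact hg
  exact ⟨.mk hv hs, fun τ => by rw [Module.Basis.mk_apply]⟩

/-! ### The direct sum decomposition -/

theorem iSupIndep_W (n : ℕ) : iSupIndep (W : Finset (Fin n) → Submodule ℝ (PermFn n)) := by
  classical
  rw [iSupIndep_iff_finsetSum_eq_zero_imp_eq_zero]
  intro s v hv hsum A hA
  have hx : ∀ B, ∃ x ∈ H B, embedding n x = if B ∈ s then v B else 0 := fun B => by
    split_ifs with h
    · exact hv B h
    · exact ⟨0, Submodule.zero_mem _, map_zero _⟩
  choose x hxH hx using hx
  have h0 := eq_zero_of_embedding_sum_eq_zero hxH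
    (by rw [map_sum, Finset.sum_congr rfl fun B _ => hx B, Finset.sum_ite_mem,
      Finset.univ_inter, hsum]) A
  have h1 := hx A
  rw [h0, map_zero, if_pos hA] at h1
  exact h1.symm

/-- This puts the constants in the same family as the other summands, so that independence of all `W
A` covers the whole decomposition. -/
theorem constFns_eq_W_empty (n : ℕ) : constFns n = W ∅ := by
  have h1 : (fun _ => 1 : PermFn n) ∈ W (∅ : Finset (Fin n)) := by
    have := wavelet_mem_W (1 : Equiv.Perm (Fin n))
    rwa [Equiv.Perm.support_one, wavelet, if_pos rfl] at this
  refine le_antisymm ?_ ?_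
  · rintro f ⟨c, hc⟩
    have : f = c • (fun _ => 1 : PermFn n) := funext fun σ => by simp [hc σ]
    exact this ▸ Submodule.smul_mem _ c h1
  · refine (W_le_span_wavelet ∅).trans (Submodule.span_le.mpr ?_)
    rintro _ ⟨⟨τ, hτ⟩, rfl⟩
    exact ⟨1, fun σ => by simp [wavelet, Equiv.Perm.support_eq_empty_iff.mp hτ]⟩

theorem span_wavelet_one (n : ℕ) :
    Submodule.span ℝ {wavelet (1 : Equiv.Perm (Fin n))} = constFns n := by
  refine le_antisymm ?_ ?_
  · rw [Submodule.span_singleton_le_iff_mem, constFns_eq_W_empty, ← Equiv.Perm.support_one]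
    exact wavelet_mem_W 1
  · rintro f ⟨c, hc⟩
    exact Submodule.mem_span_singleton.mpr ⟨c, funext fun σ => by simp [wavelet, hc σ]⟩

/-- The set of letters attached to a member of the family `multiresolution n`. -/
def indexSet {n : ℕ} : Option {A : Finset (Fin n) // 2 ≤ A.card} → Finset (Fin n)
  | none => ∅
  | some A => A.1

theorem multiresolution_eq_W {n : ℕ} : multiresolution n = W ∘ indexSet := by
  funext i
  cases i with
  | none => exact constFns_eq_W_empty n
  | some A => rfl

theorem indexSet_injective {n : ℕ} : Function.Injective (indexSet (n := n)) := by
  rintro (_ | ⟨A, hA⟩) (_ | ⟨B, hB⟩) h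
  · rfl
  · have h : ∅ = B := h
    simp [← h] at hB
  · have h : A = ∅ := h
    simp [h] at hA
  · exact congrArg some (Subtype.ext h)

/-- No permutation moves exactly one point, so omitting the singletons loses no wavelet and the
summands still span. -/
theorem exists_indexSet_eq_support {n : ℕ} (τ : Equiv.Perm (Fin n)) :
    ∃ i, indexSet i = τ.support := by
  rcases Nat.lt_or_ge τ.support.card 2 with h | h
  · have := τ.card_support_ne_one
    exact ⟨none, (Finset.card_eq_zero.mp (by omega)).symm⟩
  · exact ⟨some ⟨_, h⟩, rfl⟩

theorem isInternal_multiresolution (n : ℕ) : DirectSum.IsInternal (multiresolution n) := by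
  rw [DirectSum.isInternal_submodule_iff_iSupIndep_and_iSup_eq_top, multiresolution_eq_W]
  refine ⟨(iSupIndep_W n).comp indexSet_injective, ?_⟩
  rw [eq_top_iff, ← (waveletBasis n).span_eq, Submodule.span_le]
  rintro _ ⟨τ, rfl⟩
  obtain ⟨i, hi⟩ := exists_indexSet_eq_support τ
  rw [waveletBasis_apply]
  exact Submodule.mem_iSup_of_mem i (show wavelet τ ∈ W (indexSet i) from hi ▸ wavelet_mem_W τ)

end InjectiveWords

theorem mainTheorem4 (n : ℕ) :
    (∀ A : Finset (Fin n), 2 ≤ A.card →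
      ∃ b : Module.Basis {τ : Equiv.Perm (Fin n) // τ.support = A} ℝ (InjectiveWords.W A),
        ∀ τ, (b τ : InjectiveWords.PermFn n) = InjectiveWords.wavelet τ.1) ∧
    (∃ b : Module.Basis (Equiv.Perm (Fin n)) ℝ (InjectiveWords.PermFn n),
      ∀ τ, b τ = InjectiveWords.wavelet τ) ∧
    InjectiveWords.wavelet (1 : Equiv.Perm (Fin n)) = (fun _ => 1) ∧
    Submodule.span ℝ {InjectiveWords.wavelet (1 : Equiv.Perm (Fin n))} =
      InjectiveWords.constFns n ∧
    DirectSum.IsInternal (InjectiveWords.multiresolution n) :=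
  ⟨fun A _ => InjectiveWords.exists_basis_W A,
    ⟨InjectiveWords.waveletBasis n, InjectiveWords.waveletBasis_apply⟩,
    if_pos rfl, InjectiveWords.span_wavelet_one n, InjectiveWords.isInternal_multiresolution n⟩
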